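/- Let $M$ be a countable first-order structure, $G=\mathrm{Aut}(M)$, and for $X\subseteq M$ let $G_X$ be the group of all $g\in G$ fixing every element of $X$. Let $\mathrm{cl}$ be a closure operation on (the subsets of) $M$ which is - invariant: $\mathrm{cl}(gX)=g(\mathrm{cl}(X))$ for all $g\in G$, $X\subseteq M$; - finitary: $\mathrm{cl}(X)$ is the union of the sets $\mathrm{cl}(Y)$ over the finite subsets $Y$ of $X$, for all $X\subseteq M$; - such that it subsumes definable closure: if $X\subseteq M$ is finite and $a\in M$ is fixed by $G_{\mathrm{cl}(X)}$, then $a\in\mathrm{cl}(X)$. Let $\mathcal X=\{\mathrm{cl}(X): X\subseteq M \text{ finite}\}$, and let $\mathcal F$ be the set of bijections $f:A\to B$ with $A,B\in\mathcal X$ that extend to elements of $G$. For subsets $A,B$ and a tuple $a$, $\mathrm{cl}(a,B)$ is the closure of $B$ together with the entries of $a$; finite tuples are identified with the finite sets of their entries. Let $\mathop{\perp}$ be a stationary independence relation on $M$ compatible with $\mathrm{cl}$, i.e. a ternary relation $A\perp_B C$ such that, for all $A,B,C,D,A_1,A_2\in\mathcal X$ and all finite tuples $a,b$ from $M$: 1.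 (Compatibility) $a\perp_b C\Leftrightarrow a\perp_{\mathrm{cl}(b)}C$, and $a\perp_B C \Leftrightarrow (e\perp_B C$ for all finite tuples $e$ from $\mathrm{cl}(a,B)) \Leftrightarrow \mathrm{cl}(a,B)\perp_B C$. 2. (Invariance) If $g\in G$ and $A\perp_B C$, then $gA\perp_{gB}gC$. 3. (Monotonicity) If $A\perp_B \mathrm{cl}(C\cup D)$, then $A\perp_B C$ and $A\perp_{\mathrm{cl}(B\cup C)}D$. 4. (Transitivity) If $A\perp_B C$ and $A\perp_{\mathrm{cl}(B\cup C)}D$, then $A\perp_B\mathrm{cl}(C\cup D)$. 5. (Symmetry) If $A\perp_B C$, then $C\perp_B A$. 6. (Existence) There is $g\in G_B$ with $gA\perp_B C$. 7. (Stationarity) If $B\subseteq A_i$ and $A_i\perp_B C$ for $i=1,2$, and $h:A_1\to A_2$ in $\mathcal F$ is the identity on $B$, then there is $k\in\mathcal F$ extending both $h$ and the identity map on $C$. Suppose that every element of $G$ fixes every element of $\mathrm{cl}(\emptyset)$. Let $g\in G$ move almost maximally: for all $B\in\mathcal X$ and $a\in M$ there is $a'$ in the $G_B$-orbit of $a$ such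 that $a'\perp_B \mathrm{cl}(ga')$. Then every element of $G$ is a product of 16 conjugates of $g$ in $G$. -/

import Mathlib

open scoped FirstOrder

universe u v w

/-- `Aut(M)`: the `L`-automorphisms of `M`, as a group under composition, `(f * g) x = f (g x)`. -/
instance autGroup {L : FirstOrder.Language.{u, v}} {M : Type w} [L.Structure M] : Group (M ≃[L] M) where
  mul f g := f.comp g
  one := FirstOrder.Language.Equiv.refl L M
  inv f := f.symm
  mul_assoc _ _ _ := rfl
  one_mul _ := rfl
  mul_one _ := rfl
  inv_mul_cancel f := FirstOrder.Language.Equiv.ext fun x => f.symm_apply_apply x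

namespace StatIndep

variable {L : FirstOrder.Language.{u, v}} {M : Type w} [L.Structure M]

/-- `g ∈ G_X`: the automorphism `g` fixes every element of `X`. -/
def Fixes (g : M ≃[L] M) (X : Set M) : Prop :=
  ∀ x ∈ X, g x = x

variable (L) in
/-- `cl(gX) = g(cl(X))` for all automorphisms `g` and all `X ⊆ M`. -/
def IsInvariant (cl : ClosureOperator (Set M)) : Prop :=
  ∀ (g : M ≃[L] M) (X : Set M), cl (g '' X) = g '' cl X

/-- `cl(X)` is the union of the closures of the finite subsets of `X`. -/
def IsFinitary (cl : ClosureOperator (Set M)) : Prop :=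
  ∀ X : Set M, cl X = ⋃ Y ∈ {Y : Set M | Y ⊆ X ∧ Y.Finite}, cl Y

variable (L) in
/-- Every element fixed by `G_{cl(X)}`, for `X` finite, lies in `cl(X)`. -/
def SubsumesDcl (cl : ClosureOperator (Set M)) : Prop :=
  ∀ X : Set M, X.Finite → ∀ a : M,
    (∀ g : M ≃[L] M, Fixes g (cl X) → g a = a) → a ∈ cl X

/-- The set `𝒳` of closures of finite subsets of `M`. -/
def finClosed (cl : ClosureOperator (Set M)) : Set (Set M) :=
  {A | ∃ X : Set M, X.Finite ∧ A = cl X}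

variable (L) in
/-- `Ind A B C` is read "`A` is independent from `C` over `B`". Finite tuples are represented by
the finite sets of their entries. All axioms concern elements of `𝒳` and finite tuples only; a
juxtaposition such as `CD` of elements of `𝒳` stands for the element `cl(C ∪ D)` of `𝒳`. -/
structure IsStationaryIndep (cl : ClosureOperator (Set M))
    (Ind : Set M → Set M → Set M → Prop) : Prop where
  compat_base : ∀ a b : Set M, a.Finite → b.Finite → ∀ C ∈ finClosed cl,
    (Ind a b C ↔ Ind a (cl b) C)
  /-- Here `e` ranges over the finite tuples from `cl(a, B)`. -/
  compat_tuples : ∀ a : Set M, a.Finite → ∀ B ∈ finClosed cl, ∀ C ∈ finClosed cl,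
    (Ind a B C ↔ ∀ e : Set M, e.Finite → e ⊆ cl (a ∪ B) → Ind e B C)
  compat_closure : ∀ a : Set M, a.Finite → ∀ B ∈ finClosed cl, ∀ C ∈ finClosed cl,
    (Ind a B C ↔ Ind (cl (a ∪ B)) B C)
  invariance : ∀ g : M ≃[L] M,
    ∀ A ∈ finClosed cl, ∀ B ∈ finClosed cl, ∀ C ∈ finClosed cl,
      Ind A B C → Ind (g '' A) (g '' B) (g '' C)
  monotonicity : ∀ A ∈ finClosed cl, ∀ B ∈ finClosed cl,
    ∀ C ∈ finClosed cl, ∀ D ∈ finClosed cl,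
      Ind A B (cl (C ∪ D)) → Ind A B C ∧ Ind A (cl (B ∪ C)) D
  transitivity : ∀ A ∈ finClosed cl, ∀ B ∈ finClosed cl,
    ∀ C ∈ finClosed cl, ∀ D ∈ finClosed cl,
      Ind A B C → Ind A (cl (B ∪ C)) D → Ind A B (cl (C ∪ D))
  symmetry : ∀ A ∈ finClosed cl, ∀ B ∈ finClosed cl, ∀ C ∈ finClosed cl,
    Ind A B C → Ind C B A
  existence : ∀ A ∈ finClosed cl, ∀ B ∈ finClosed cl, ∀ C ∈ finClosed cl,
    ∃ g : M ≃[L] M, Fixes g B ∧ Ind (g '' A) B C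
  /-- A partial automorphism `A₁ → A₂` is the restriction to `A₁` of some `h ∈ G` with
  `h(A₁) = A₂`; the extension of `h|A₁ ∪ id_C` is the restriction of `k` to `cl(A₁ ∪ C)`. -/
  stationarity : ∀ A₁ ∈ finClosed cl, ∀ A₂ ∈ finClosed cl,
    ∀ B ∈ finClosed cl, ∀ C ∈ finClosed cl,
      B ⊆ A₁ → B ⊆ A₂ → Ind A₁ B C → Ind A₂ B C →
      ∀ h : M ≃[L] M, h '' A₁ = A₂ → Fixes h B →
        ∃ k : M ≃[L] M, (∀ x ∈ A₁, k x = h x) ∧ Fixes k C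

/-- For all `B ∈ 𝒳` and `a ∈ M` there is `a'` in the `G_B`-orbit of `a` that is independent from
`g a'` over `B`. As the right-hand argument of the independence relation is an element of `𝒳`, the
element `g a'` is represented there by its closure. -/
def MovesAlmostMaximally (cl : ClosureOperator (Set M))
    (Ind : Set M → Set M → Set M → Prop) (g : M ≃[L] M) : Prop :=
  ∀ B ∈ finClosed cl, ∀ a : M, ∃ f : M ≃[L] M, Fixes f B ∧
    Ind {f a} B (cl {g (f a)})

end StatIndep

/-! Call `γ` maximally moving if every type over a finite set `X` has a realisation `x` with `x`
free from `γX, γx` over `X` and `x, X` free from `γx` over `γX`. Two facts give the theorem.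

If `g` moves almost maximally, then some `γ = h⁻¹ g h g` moves maximally (`exists_movesMaximally`).
Here `h` is the limit of a sequence of finite approximations. Given a type over `X`, an
approximation is extended so that `h` carries `g a` to a point `b` that almost maximality makes free
from `g b`, and `h⁻¹` carries `g b` to a point free over the image of `X`
(`exists_forces_movesType`).

If `γ` moves maximally, every `k` is a product of eight conjugates of `γ`. Stationarity lets a
conjugate of `γ` realise any free one-step extension of `γ`. A product of four conjugates then
realises every extension of its action on a suitable finite set: push forward one step, pull back
one step, and meet freely in the middle (`exists_conj_mul_agreeOn`). So the map from 4-tuples to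
products of conjugates has somewhere dense image on each basic open set. An explicit back-and-forth,
in place of a Baire category argument, yields two tuples whose products multiply to `k`
(`exists_conjProd_mul_conjProd`).

Each conjugate of `γ` is a product of two conjugates of `g`, whence 16. -/

open scoped Pointwise

namespace StatIndep

/-! ### Finite independence calculus and maximally moving elements. -/

section Calculus

variable {G : Type*} {M : Type*} [Group G] [MulAction G M]

/-- `g` and `h` agree on the closure of the finite set `F`. -/
def AgreeOn (cl : ClosureOperator (Set M)) (g h : G) (F : Finset M) : Prop :=
  ∀ x ∈ cl (F : Set M), g • x = h • x

variable {cl : ClosureOperator (Set M)}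

namespace AgreeOn

variable {g h k : G} {F F' : Finset M}

theorem refl (g : G) (F : Finset M) : AgreeOn cl g g F := fun _ _ => rfl

theorem symm (H : AgreeOn cl g h F) : AgreeOn cl h g F := fun x hx => (H x hx).symm

theorem trans (H : AgreeOn cl g h F) (H' : AgreeOn cl h k F) : AgreeOn cl g k F :=
  fun x hx => (H x hx).trans (H' x hx)

theorem mono (H : AgreeOn cl g h F) (hF : F' ⊆ F) : AgreeOn cl g h F' :=
  fun x hx => H x (cl.monotone (Finset.coe_subset.2 hF) hx)

theorem smul_eq (H : AgreeOn cl g h F) {x : M} (hx : x ∈ F) : g • x = h • x :=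
  H x (cl.le_closure _ hx)

theorem mul_left (H : AgreeOn cl g h F) (p : G) : AgreeOn cl (p * g) (p * h) F :=
  fun x hx => by rw [mul_smul, mul_smul, H x hx]

end AgreeOn

variable [DecidableEq M]

variable (G) in
/-- The properties of an independence relation between (closures of) finite sets, for a group `G`
acting on `M`. -/
structure FinsetIndep (cl : ClosureOperator (Set M))
    (I : Finset M → Finset M → Finset M → Prop) : Prop where
  cl_smul : ∀ (g : G) (X : Set M), cl (g • X) = g • cl X
  smul : ∀ (g : G) {A B C}, I A B C → I (g • A) (g • B) (g • C)
  symm : ∀ {A B C}, I A B C → I C B A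
  union_iff : ∀ {A B C D}, I A B (C ∪ D) ↔ I A B C ∧ I A (B ∪ C) D
  self_right : ∀ A B, I A B B
  existence : ∀ A B C, ∃ g : G, AgreeOn cl g 1 B ∧ I (g • A) B C
  stationarity : ∀ {A B C} {h : G}, AgreeOn cl h 1 B → I A B C → I (h • A) B C →
    ∃ k : G, AgreeOn cl k h (A ∪ B) ∧ AgreeOn cl k 1 C

variable {I : Finset M → Finset M → Finset M → Prop}

namespace AgreeOn

variable {g h k : G} {F F' : Finset M}

theorem smul_finset_eq (H : AgreeOn cl g h F) (hF : F' ⊆ F) : g • F' = h • F' :=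
  Finset.image_congr fun _ hx => H.smul_eq (hF hx)

theorem mul_right (hI : FinsetIndep G cl I) {p : G} (H : AgreeOn cl g h (p • F)) :
    AgreeOn cl (g * p) (h * p) F := fun x hx => by
  rw [mul_smul, mul_smul]
  refine H _ ?_
  rw [Finset.coe_smul_finset, hI.cl_smul]
  exact Set.smul_mem_smul_set hx

theorem mul (hI : FinsetIndep G cl I) {p q : G} (H : AgreeOn cl g h (p • F))
    (H' : AgreeOn cl p q F) : AgreeOn cl (g * p) (h * q) F :=
  (mul_right hI H).trans (H'.mul_left h)

theorem mul' (hI : FinsetIndep G cl I) {p q : G} (H : AgreeOn cl g h (q • F))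
    (H' : AgreeOn cl p q F) : AgreeOn cl (g * p) (h * q) F :=
  mul hI (by rwa [H'.smul_finset_eq subset_rfl]) H'

theorem inv (hI : FinsetIndep G cl I) (H : AgreeOn cl g h F) :
    AgreeOn cl g⁻¹ h⁻¹ (g • F) := fun x hx => by
  rw [Finset.coe_smul_finset, hI.cl_smul] at hx
  obtain ⟨y, hy, rfl⟩ := hx
  change g⁻¹ • g • y = h⁻¹ • g • y
  rw [H y hy, inv_smul_smul, ← H y hy, inv_smul_smul]

theorem inv_one (hI : FinsetIndep G cl I) (H : AgreeOn cl g 1 F) : AgreeOn cl g⁻¹ 1 F := by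
  have := inv hI H
  rwa [H.smul_finset_eq subset_rfl, one_smul, _root_.inv_one] at this

theorem smul_finset_eq_self (H : AgreeOn cl g 1 F) (hF : F' ⊆ F) : g • F' = F' := by
  rw [H.smul_finset_eq hF, one_smul]

theorem inv_smul_finset_subset (H : AgreeOn cl g h F) (hF : h⁻¹ • F' ⊆ F) : g⁻¹ • F' ⊆ F := by
  have := H.smul_finset_eq hF
  rw [smul_inv_smul, ← eq_inv_smul_iff] at this
  rwa [← this]

end AgreeOn

namespace FinsetIndep

variable {A B C D : Finset M}

theorem left (hI : FinsetIndep G cl I) (H : I A B (C ∪ D)) : I A B C := (hI.union_iff.1 H).1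

theorem mono (hI : FinsetIndep G cl I) (H : I A B D) (h : C ⊆ D) : I A B C :=
  hI.left (D := D) (by rwa [Finset.union_eq_right.2 h])

theorem mono_left (hI : FinsetIndep G cl I) (H : I D B C) (h : A ⊆ D) : I A B C :=
  hI.symm (hI.mono (hI.symm H) h)

/-- Part of the right-hand side may be moved into the base. -/
theorem base_of_union (hI : FinsetIndep G cl I) (H : I A B (C ∪ D)) : I A (B ∪ C) D :=
  (hI.union_iff.1 H).2

theorem trans (hI : FinsetIndep G cl I) (H : I A B C) (hD : I A (B ∪ C) D) : I A B (C ∪ D) :=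
  hI.union_iff.2 ⟨H, hD⟩

/-- Transitivity when the base of the second relation contains that of the first. -/
theorem trans_of_subset (hI : FinsetIndep G cl I) (hBC : B ⊆ C) (H : I A B C) (H' : I A C D) :
    I A B (C ∪ D) :=
  hI.trans H (by rwa [Finset.union_eq_right.2 hBC])

/-- Monotonicity when the new base contains the old one and lies in the right-hand side. -/
theorem base_mono (hI : FinsetIndep G cl I) (H : I A B D) (hBC : B ⊆ C) (hCD : C ⊆ D) :
    I A C D := by
  have := hI.base_of_union (C := C) (D := D) (by rwa [Finset.union_eq_right.2 hCD])
  rwa [Finset.union_eq_right.2 hBC] at this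

theorem union_base (hI : FinsetIndep G cl I) (H : I A B C) : I A B (B ∪ C) :=
  hI.trans (hI.self_right A B) (by rwa [Finset.union_self])

/-- Stationarity relative to a map `m` that need not be the identity. -/
theorem stationarity_map (hI : FinsetIndep G cl I) {h m : G} (hm : AgreeOn cl h m B)
    (H : I A B C) (H' : I (h • A) (h • B) (m • C)) :
    ∃ k : G, AgreeOn cl k h (A ∪ B) ∧ AgreeOn cl k m C := by
  -- Translating by `m⁻¹` reduces to a map that is the identity on the base.
  have h1 : AgreeOn cl (m⁻¹ * h) 1 B := by simpa using hm.mul_left m⁻¹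
  have h2 := hI.smul m⁻¹ H'
  rw [inv_smul_smul, ← mul_smul, ← mul_smul, h1.smul_finset_eq_self subset_rfl] at h2
  obtain ⟨k, hk, hk'⟩ := hI.stationarity h1 H h2
  exact ⟨m * k, by simpa using hk.mul_left m, by simpa using hk'.mul_left m⟩

end FinsetIndep

/-- Every type over a finite set has a realisation that is moved by `γ` as freely as possible. -/
def MovesMaximally (cl : ClosureOperator (Set M)) (I : Finset M → Finset M → Finset M → Prop)
    (γ : G) : Prop :=
  ∀ X x : Finset M, ∃ u : G, AgreeOn cl u 1 X ∧ I (u • x) X (γ • X ∪ γ • u • x) ∧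
    I (u • x ∪ X) (γ • X) (γ • u • x)

namespace MovesMaximally

variable {γ : G}

/-- Symmetry exchanges the two independence clauses when `x, X` trade places with their images. This
permits pulling back as well as pushing forward. -/
theorem inv (hI : FinsetIndep G cl I) (H : MovesMaximally cl I γ) :
    MovesMaximally cl I γ⁻¹ := fun X x => by
  obtain ⟨u, hu, h1, h2⟩ := H (γ⁻¹ • X) (γ⁻¹ • x)
  rw [smul_inv_smul] at h1 h2
  refine ⟨γ * u * γ⁻¹, ?_, ?_, ?_⟩
  · have := AgreeOn.mul_right hI (hu.mul_left γ)
    simpa using this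
  · simp only [mul_smul, inv_smul_smul]
    rw [Finset.union_comm]
    exact hI.symm h2
  · simp only [mul_smul, inv_smul_smul]
    rw [Finset.union_comm]
    exact hI.symm h1

theorem conj (hI : FinsetIndep G cl I) (H : MovesMaximally cl I γ) (h : G) :
    MovesMaximally cl I (h⁻¹ * γ * h) := fun X x => by
  obtain ⟨u, hu, h1, h2⟩ := H (h • X) (h • x)
  refine ⟨h⁻¹ * u * h, ?_, ?_, ?_⟩
  · have := AgreeOn.mul_right hI (hu.mul_left h⁻¹)
    simpa using this
  · have := hI.smul h⁻¹ h1
    simpa only [mul_smul, smul_inv_smul, inv_smul_smul, Finset.smul_finset_union] using this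
  · have := hI.smul h⁻¹ h2
    simpa only [mul_smul, smul_inv_smul, inv_smul_smul, Finset.smul_finset_union] using this

/-- It is enough to consider types of single elements. -/
theorem of_singleton (hI : FinsetIndep G cl I)
    (H : ∀ (X : Finset M) (a : M), ∃ u : G, AgreeOn cl u 1 X ∧
      I {u • a} X (γ • X ∪ {γ • u • a}) ∧ I ({u • a} ∪ X) (γ • X) {γ • u • a}) :
    MovesMaximally cl I γ := fun X x => by
  induction x using Finset.induction_on with
  | empty =>
    refine ⟨1, AgreeOn.refl _ _, ?_, ?_⟩
    · exact hI.symm (hI.mono (hI.self_right _ _) (by simp))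
    · exact hI.mono (hI.self_right _ _) (by simp)
  | insert a x _ ih =>
    obtain ⟨u, hu, h1, h2⟩ := ih
    -- The new point is realised over the part already placed, so `v` does not disturb `u • x`.
    obtain ⟨v, hv, h3, h4⟩ := H (X ∪ u • x) (u • a)
    have hvx : v • u • x = u • x := hv.smul_finset_eq_self Finset.subset_union_right
    have e : (v * u) • (insert a x) = u • x ∪ {v • u • a} := by
      rw [Finset.insert_eq, Finset.smul_finset_union, mul_smul, mul_smul, hvx,
        Finset.smul_finset_singleton, Finset.smul_finset_singleton, Finset.union_comm]
    refine ⟨v * u, ?_, ?_, ?_⟩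
    · exact (AgreeOn.mul_left hu v).trans (by simpa using hv.mono Finset.subset_union_left)
    all_goals
      rw [e]
      generalize v • u • a = b at *
      generalize u • x = y at *
      simp only [Finset.smul_finset_union, Finset.smul_finset_singleton] at *
    · have h5 : I (γ • X ∪ γ • y) X (y ∪ {b}) :=
        hI.trans (hI.symm h1) (hI.symm (hI.left h3))
      have h6 : I {γ • b} (X ∪ (γ • X ∪ γ • y)) (y ∪ {b}) := by
        have : I {γ • b} (γ • X ∪ γ • y) (X ∪ (y ∪ {b})) := by
          refine hI.mono (hI.symm h4) ?_
          grind
        rw [Finset.union_comm X]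
        exact hI.base_of_union this
      have := hI.trans (hI.symm h5) (hI.symm h6)
      rwa [Finset.union_assoc] at this
    · have h5 : I (γ • y) (γ • X) (y ∪ X ∪ {b}) := by
        refine hI.trans (hI.symm h2) ?_
        refine hI.symm ?_
        convert hI.base_of_union (hI.left h3) using 1
        grind
      have := hI.trans (hI.symm h5) (D := {γ • b}) (hI.mono_left h4 (by grind))
      refine hI.mono_left this ?_
      grind

end MovesMaximally

end Calculus

/-! ### Realising extensions by conjugates. -/

section Density

variable {G : Type*} {M : Type*} [Group G] [MulAction G M] [DecidableEq M]
  {cl : ClosureOperator (Set M)} {I : Finset M → Finset M → Finset M → Prop}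

/-- An extension `f` of `g` from `X₀` to `x₀`, taking `x₀` to a free position, is realised by a
conjugate of `g`. -/
theorem MovesMaximally.exists_conj_agreeOn (hI : FinsetIndep G cl I) {g : G}
    (H : MovesMaximally cl I g) {X₀ X₁ x₀ : Finset M} (hX : g • X₀ = X₁) {f : G}
    (hf : AgreeOn cl f g X₀) (h0 : I x₀ X₀ X₁) (h1 : I (f • x₀) X₁ (x₀ ∪ X₀)) :
    ∃ a : G, AgreeOn cl a 1 (X₀ ∪ X₁) ∧ AgreeOn cl (a⁻¹ * g * a) f (x₀ ∪ X₀) := by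
  obtain ⟨u, hu, -, h3⟩ := H (X₀ ∪ X₁) x₀
  have hu0 : AgreeOn cl u 1 X₀ := hu.mono Finset.subset_union_left
  have hu1 : AgreeOn cl u 1 X₁ := hu.mono Finset.subset_union_right
  have hfX : f • X₀ = X₁ := (hf.smul_finset_eq subset_rfl).trans hX
  have h4 : I (g • u • x₀) X₁ (g • X₁) := by
    have := hI.smul g (hI.smul u h0)
    rwa [hu0.smul_finset_eq_self subset_rfl, hu1.smul_finset_eq_self subset_rfl, hX] at this
  have h5 : I (g • u • x₀) X₁ (u • x₀ ∪ (X₀ ∪ X₁)) := by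
    rw [Finset.smul_finset_union, hX] at h3
    exact hI.mono (hI.trans h4 (hI.symm h3)) Finset.subset_union_right
  have hm : AgreeOn cl (g * u * f⁻¹) u X₁ := by
    have e1 : AgreeOn cl f⁻¹ g⁻¹ X₁ := by simpa only [hfX] using hf.inv hI
    have e2 : AgreeOn cl (g * u * g⁻¹) 1 X₁ := by
      have : AgreeOn cl (g * u) (g * 1) (g⁻¹ • X₁) := by
        rw [← hX, inv_smul_smul]
        exact hu0.mul_left g
      simpa using this.mul_right hI
    exact ((e1.mul_left (g * u)).trans e2).trans hu1.symm
  -- Both `f • x₀` and `g • u • x₀` are free over `X₁`, so one `k` acts as `u` on `x₀, X₀, X₁` and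
  -- takes `f • x₀` to `g • u • x₀`. Conjugating `g` by `k` then gives `f`.
  obtain ⟨k, hk, hk'⟩ := hI.stationarity_map (A := f • x₀) (B := X₁) (C := x₀ ∪ (X₀ ∪ X₁)) hm
    (hI.mono (hI.union_base h1) (by grind)) (by
      rw [hm.smul_finset_eq subset_rfl, hu1.smul_finset_eq_self subset_rfl,
        Finset.smul_finset_union, hu.smul_finset_eq_self subset_rfl]
      simpa only [mul_smul, inv_smul_smul] using h5)
  refine ⟨k, (hk'.mono Finset.subset_union_right).trans hu, ?_⟩
  have e1 : AgreeOn cl (k * f) (g * u) (x₀ ∪ X₀) := by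
    have : AgreeOn cl k (g * u * f⁻¹) (f • (x₀ ∪ X₀)) := by
      rwa [Finset.smul_finset_union, hfX]
    simpa using this.mul_right hI
  have e2 : AgreeOn cl (g * k) (g * u) (x₀ ∪ X₀) := (hk'.mono (by grind)).mul_left g
  simpa [mul_assoc] using (e2.trans e1.symm).mul_left k⁻¹

/-- A conjugate of `g` takes `x` to a position that is free from `C` over `Y`. -/
theorem MovesMaximally.exists_conj_indep (hI : FinsetIndep G cl I) {g : G}
    (H : MovesMaximally cl I g) {X Y C : Finset M} (h : I X Y C)
    (x : Finset M) :
    ∃ a : G, AgreeOn cl a 1 (X ∪ Y) ∧ I ((a⁻¹ * g * a) • x) Y C := by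
  obtain ⟨u, hu, h1, -⟩ := H (X ∪ Y) x
  -- Since `v` fixes `x`, conjugating by `v` moves only the image of `x`, making it free from `C`.
  obtain ⟨v, hv, h2⟩ := hI.existence (u⁻¹ • g • u • x) (X ∪ Y ∪ x) C
  have hv1 : AgreeOn cl v 1 (X ∪ Y) := hv.mono Finset.subset_union_left
  have hvx : v⁻¹ • x = x := (hv.inv_one hI).smul_finset_eq_self Finset.subset_union_right
  refine ⟨u * v⁻¹, ((hv1.inv_one hI).mul_left u).trans (by simpa using hu), ?_⟩
  have e : ((u * v⁻¹)⁻¹ * g * (u * v⁻¹)) • x = v • u⁻¹ • g • u • x := by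
    simp only [mul_inv_rev, inv_inv, mul_smul, hvx]
  rw [e]
  have h3 : I (v • u⁻¹ • g • u • x) (X ∪ Y) x := by
    have := hI.smul v (hI.smul u⁻¹ (hI.mono h1 Finset.subset_union_right))
    rw [inv_smul_smul, (hu.inv_one hI).smul_finset_eq_self subset_rfl,
      hv1.smul_finset_eq_self subset_rfl,
      hv.smul_finset_eq_self Finset.subset_union_right] at this
    exact hI.symm this
  have h4 : I (v • u⁻¹ • g • u • x) (X ∪ Y) C :=
    hI.mono (hI.trans h3 h2) Finset.subset_union_right
  rw [Finset.union_comm] at h4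
  exact hI.symm (hI.mono (hI.trans (hI.symm h) (hI.symm h4)) Finset.subset_union_right)

/-- Conjugates of four maximally moving elements compose to any prescribed extension of their
composite on a sufficiently free chain. -/
theorem exists_conj_mul_agreeOn (hI : FinsetIndep G cl I) {g₁ g₂ g₃ g₄ : G}
    (H₁ : MovesMaximally cl I g₁) (H₂ : MovesMaximally cl I g₂) (H₃ : MovesMaximally cl I g₃)
    (H₄ : MovesMaximally cl I g₄) {Y₀ Y₁ Y₂ Y₃ Y₄ : Finset M} (e₁ : g₁ • Y₀ = Y₁)
    (e₂ : g₂ • Y₁ = Y₂) (e₃ : g₃ • Y₂ = Y₃) (e₄ : g₄ • Y₃ = Y₄) (h₀ : I Y₀ Y₁ Y₂)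
    (h₄ : I Y₄ Y₃ Y₂) {k : G} (hk : AgreeOn cl k (g₄ * g₃ * g₂ * g₁) Y₀) (E : Finset M) :
    ∃ a₁ a₂ a₃ a₄ : G, AgreeOn cl a₁ 1 (Y₀ ∪ Y₁) ∧ AgreeOn cl a₂ 1 (Y₁ ∪ Y₂) ∧
      AgreeOn cl a₃ 1 (Y₂ ∪ Y₃) ∧ AgreeOn cl a₄ 1 (Y₃ ∪ Y₄) ∧
      AgreeOn cl ((a₄⁻¹ * g₄ * a₄) * (a₃⁻¹ * g₃ * a₃) * (a₂⁻¹ * g₂ * a₂) * (a₁⁻¹ * g₁ * a₁))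
        k E := by
  have conj_agree : ∀ {a g : G} {X Y : Finset M}, g • X = Y → AgreeOn cl a 1 (X ∪ Y) →
      AgreeOn cl (a⁻¹ * g * a) g X := by
    intro a g X Y e ha
    have ha1 : AgreeOn cl a 1 X := ha.mono Finset.subset_union_left
    have ha2 : AgreeOn cl a⁻¹ 1 (g • X) :=
      (ha.mono (by rw [e]; exact Finset.subset_union_right)).inv_one hI
    have := (ha1.mul_left (a⁻¹ * g)).trans (by simpa using ha2.mul_right hI)
    exact this
  have e₃' : g₃⁻¹ • Y₃ = Y₂ := by rw [← e₃, inv_smul_smul]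
  have e₄' : g₄⁻¹ • Y₄ = Y₃ := by rw [← e₄, inv_smul_smul]
  obtain ⟨a₁, ha₁, hx₁⟩ := H₁.exists_conj_indep hI h₀ E
  obtain ⟨a₄, ha₄, hx₃⟩ := (H₄.inv hI).exists_conj_indep hI h₄ (k • E)
  have hg₁ := conj_agree e₁ ha₁
  have hg₄ : AgreeOn cl (a₄⁻¹ * g₄⁻¹ * a₄) g₄⁻¹ Y₄ := conj_agree e₄' ha₄
  set g₁' := a₁⁻¹ * g₁ * a₁ 
  have hinv : a₄⁻¹ * g₄⁻¹ * a₄ = (a₄⁻¹ * g₄ * a₄)⁻¹ := by group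
  rw [hinv] at hg₄ hx₃
  set g₄' := a₄⁻¹ * g₄ * a₄ 
  -- The meeting point is placed free over `Y₂` from both the pushed-forward `E` and the pulled-back
  -- `k • E`. This supplies the freeness needed to extend `g₂` forwards and `g₃⁻¹` backwards.
  obtain ⟨v, hv, hx₂⟩ := hI.existence (g₂ • g₁' • E) Y₂
    ((g₁' • E ∪ Y₁) ∪ (g₄'⁻¹ • k • E ∪ Y₃))
  have hv' : AgreeOn cl (v * g₂) g₂ Y₁ := by
    have : AgreeOn cl v 1 (g₂ • Y₁) := by rwa [e₂]
    simpa using this.mul_right hI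
  obtain ⟨a₂, ha₂, hf₂⟩ := H₂.exists_conj_agreeOn hI e₂ hv' hx₁
    (by
      rw [mul_smul]
      exact hI.mono hx₂ Finset.subset_union_left)
  have e₁' : g₁' • Y₀ = Y₁ := by rw [hg₁.smul_finset_eq subset_rfl, e₁]
  have hchain : AgreeOn cl (v * g₂ * g₁') (g₂ * g₁) Y₀ :=
    AgreeOn.mul hI (by rwa [e₁']) hg₁
  have hkY : k • Y₀ = Y₄ := by
    rw [hk.smul_finset_eq subset_rfl, mul_smul, mul_smul, mul_smul, e₁, e₂, e₃, e₄]
  have hchain' : AgreeOn cl (g₄'⁻¹ * k) (g₃ * (g₂ * g₁)) Y₀ := by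
    have := AgreeOn.mul hI (by rwa [hkY]) hk (g := g₄'⁻¹)
    simpa [mul_assoc] using this
  have hback : AgreeOn cl (v * g₂ * g₁' * (g₄'⁻¹ * k)⁻¹) g₃⁻¹ Y₃ := by
    have c1 := hchain'.inv hI
    have eY : (g₄'⁻¹ * k) • Y₀ = Y₃ := by
      rw [hchain'.smul_finset_eq subset_rfl, mul_smul, mul_smul, e₁, e₂, e₃]
    have eY' : (g₄'⁻¹ * k)⁻¹ • Y₃ = Y₀ := by rw [← eY, inv_smul_smul]
    rw [eY] at c1
    have := AgreeOn.mul hI (by rwa [eY']) c1 (g := v * g₂ * g₁')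
    simpa [mul_assoc] using this
  obtain ⟨a₃, ha₃, hf₃⟩ := (H₃.inv hI).exists_conj_agreeOn hI e₃' hback hx₃
    (by
      simp only [mul_inv_rev, inv_inv, mul_smul, smul_inv_smul, inv_smul_smul]
      exact hI.mono hx₂ Finset.subset_union_right)
  refine ⟨a₁, a₂, a₃, a₄, ha₁, ha₂, by rwa [Finset.union_comm], by rwa [Finset.union_comm], ?_⟩
  have hf₃' : AgreeOn cl (a₃⁻¹ * g₃ * a₃) ((g₄'⁻¹ * k) * (v * g₂ * g₁')⁻¹)
      (v • g₂ • g₁' • E) := by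
    have := hf₃.mono (Finset.subset_union_left)
    rw [show a₃⁻¹ * g₃⁻¹ * a₃ = (a₃⁻¹ * g₃ * a₃)⁻¹ by group] at this
    have eE := this.smul_finset_eq subset_rfl
    have := this.inv hI
    rw [eE] at this
    simpa [mul_smul, mul_assoc] using this
  have hf₂' := (hf₂.mono Finset.subset_union_left).mul_right hI
  have eE : (a₂⁻¹ * g₂ * a₂ * g₁') • E = v • g₂ • g₁' • E := by
    rw [hf₂'.smul_finset_eq subset_rfl, mul_smul, mul_smul]
  have := (AgreeOn.mul hI (by rwa [eE]) hf₂').mul_left g₄'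
  simpa [mul_assoc, g₁', g₄'] using this

end Density

/-! ### Limits and the back-and-forth for eight conjugates. -/

section BackAndForth

variable {G : Type*} {M : Type*} [Group G] [MulAction G M]

variable (G M) in
/-- A sequence in `G` that stabilises on an increasing sequence of sets, exhausting `M` both in
the domain and in the range, has a limit in `G`. -/
def HasLimits : Prop :=
  ∀ (h : ℕ → G) (D : ℕ → Set M), Monotone D → (∀ n, ∀ x ∈ D n, h (n + 1) • x = h n • x) →
    (∀ x, ∃ n, x ∈ D n) → (∀ x, ∃ n, (h n)⁻¹ • x ∈ D n) →
    ∃ l : G, ∀ n, ∀ x ∈ D n, l • x = h n • x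

theorem exists_monotone_finset_exhaustion (M : Type*) [Countable M] :
    ∃ S : ℕ → Finset M, Monotone S ∧ ∀ x, ∃ n, x ∈ S n := by
  obtain ⟨e, he⟩ := exists_injective_nat M
  have hfin : ∀ n, (e ⁻¹' Set.Iio n).Finite := fun n =>
    (Set.finite_Iio n).preimage he.injOn
  refine ⟨fun n => (hfin n).toFinset, fun m n hmn x hx => ?_, fun x => ⟨e x + 1, by simp⟩⟩
  simp only [Set.Finite.mem_toFinset, Set.mem_preimage, Set.mem_Iio] at hx ⊢
  exact hx.trans_le hmn

theorem exists_seq_of_forall_exists {α : Type*} (a : α) {R : ℕ → α → α → Prop}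
    (H : ∀ n x, ∃ y, R n x y) : ∃ f : ℕ → α, f 0 = a ∧ ∀ n, R n (f n) (f (n + 1)) := by
  choose next hnext using H
  exact ⟨fun n => Nat.rec a next n, rfl, fun n => hnext n _⟩

/-- The product of the conjugates of `γ` by the entries of `h`. -/
def conjProd (γ : G) (h : Fin 4 → G) : G :=
  ((h 0)⁻¹ * γ * h 0) * ((h 1)⁻¹ * γ * h 1) * ((h 2)⁻¹ * γ * h 2) * ((h 3)⁻¹ * γ * h 3)

variable [DecidableEq M] {cl : ClosureOperator (Set M)}
  {I : Finset M → Finset M → Finset M → Prop} {γ : G}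

theorem HasLimits.exists_limit (hlim : HasLimits G M) {S F : ℕ → Finset M} {h : ℕ → G}
    (hS : ∀ x, ∃ n, x ∈ S n)
    (hF : ∀ n, F n ⊆ F (n + 1)) (hh : ∀ n, AgreeOn cl (h (n + 1)) (h n) (F n))
    (h1 : ∀ n, S n ⊆ F (n + 1)) (h2 : ∀ n, (h (n + 1))⁻¹ • S n ⊆ F (n + 1)) :
    ∃ l : G, ∀ n, AgreeOn cl l (h n) (F n) := by
  refine hlim h (fun n => cl (F n : Set M)) ?_ hh ?_ ?_
  · exact monotone_nat_of_le_succ fun n => cl.monotone (Finset.coe_subset.2 (hF n))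
  · intro x
    obtain ⟨n, hn⟩ := hS x
    exact ⟨n + 1, cl.le_closure _ (h1 n hn)⟩
  · intro x
    obtain ⟨n, hn⟩ := hS x
    exact ⟨n + 1, cl.le_closure _ (h2 n (Finset.smul_mem_smul_finset hn))⟩

theorem exists_agreeOn_conj (hI : FinsetIndep G cl I) (γ h : G) (E : Finset M) :
    ∃ F : Finset M, ∀ h' : G, AgreeOn cl h' h F →
      AgreeOn cl (h'⁻¹ * γ * h') (h⁻¹ * γ * h) E := by
  -- The second set controls `h'⁻¹` on `γ • h • E`.
  refine ⟨E ∪ (h⁻¹ * γ * h) • E, fun h' hh => ?_⟩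
  have e1 : AgreeOn cl (γ * h') (γ * h) E := (hh.mono Finset.subset_union_left).mul_left γ
  have e2 := (hh.symm.mono (Finset.subset_union_right)).inv hI
  rw [← mul_smul, show h * (h⁻¹ * γ * h) = γ * h by group] at e2
  simpa [mul_assoc] using AgreeOn.mul' hI e2.symm e1

/-- `conjProd γ` is continuous. -/
theorem exists_agreeOn_conjProd (hI : FinsetIndep G cl I) (γ : G) (h : Fin 4 → G)
    (E : Finset M) : ∃ F : Finset M, ∀ h' : Fin 4 → G, (∀ i, AgreeOn cl (h' i) (h i) F) →
      AgreeOn cl (conjProd γ h') (conjProd γ h) E := by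
  choose F hF using exists_agreeOn_conj (cl := cl) hI γ
  set c : Fin 4 → G := fun i => (h i)⁻¹ * γ * h i with hc
  refine ⟨F (h 3) E ∪ F (h 2) (c 3 • E) ∪ F (h 1) (c 2 • c 3 • E) ∪
    F (h 0) (c 1 • c 2 • c 3 • E), fun h' hh => ?_⟩
  have e3 := hF (h 3) E (h' 3) ((hh 3).mono (by grind))
  have e2 := hF (h 2) (c 3 • E) (h' 2) ((hh 2).mono (by grind))
  have e1 := hF (h 1) (c 2 • c 3 • E) (h' 1) ((hh 1).mono (by grind))
  have e0 := hF (h 0) (c 1 • c 2 • c 3 • E) (h' 0) ((hh 0).mono (by grind))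
  exact ((e0.mul' hI e1).mul' hI e2).mul' hI e3

/-- Every extension of `conjProd γ h` from `E₀` to a finite set is realised by a tuple that agrees
with `h` on `F`. -/
def IsFree (cl : ClosureOperator (Set M)) (γ : G) (h : Fin 4 → G) (F E₀ : Finset M) : Prop :=
  ∀ k : G, AgreeOn cl k (conjProd γ h) E₀ → ∀ E : Finset M,
    ∃ h' : Fin 4 → G, (∀ i, AgreeOn cl (h' i) (h i) F) ∧ AgreeOn cl (conjProd γ h') k E

/-- Each correcting element fixes two consecutive sets of the chain. One of these is always `Y₁` or
`Y₃`, so containing `F` in those two protects all four entries. Index 3 acts first. -/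
theorem isFree_of_chain (hI : FinsetIndep G cl I) (H : MovesMaximally cl I γ) (h : Fin 4 → G)
    {F Y₀ Y₁ Y₂ Y₃ Y₄ : Finset M} (e₁ : ((h 3)⁻¹ * γ * h 3) • Y₀ = Y₁)
    (e₂ : ((h 2)⁻¹ * γ * h 2) • Y₁ = Y₂) (e₃ : ((h 1)⁻¹ * γ * h 1) • Y₂ = Y₃)
    (e₄ : ((h 0)⁻¹ * γ * h 0) • Y₃ = Y₄) (h₀ : I Y₀ Y₁ Y₂) (h₄ : I Y₄ Y₃ Y₂)
    (hF₁ : F ⊆ Y₁) (hF₃ : F ⊆ Y₃) : IsFree cl γ h F Y₀ := by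
  intro k hk E
  obtain ⟨a₁, a₂, a₃, a₄, ha₁, ha₂, ha₃, ha₄, ha⟩ := exists_conj_mul_agreeOn hI
    (H.conj hI (h 3)) (H.conj hI (h 2)) (H.conj hI (h 1)) (H.conj hI (h 0)) e₁ e₂ e₃ e₄ h₀ h₄
    hk E
  have agree : ∀ {a b : G} {Y : Finset M}, AgreeOn cl a 1 Y → F ⊆ Y → AgreeOn cl (b * a) b F := by
    intro a b Y ha hY
    simpa using (ha.mono hY).mul_left b
  refine ⟨![h 0 * a₄, h 1 * a₃, h 2 * a₂, h 3 * a₁], ?_, ?_⟩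
  · simp only [Fin.forall_fin_succ]
    exact ⟨agree ha₄ (by grind), agree ha₃ (by grind), agree ha₂ (by grind),
      agree ha₁ (by grind), fun i => i.elim0⟩
  · simpa [conjProd, mul_assoc] using ha

theorem exists_isFree (hI : FinsetIndep G cl I) (H : MovesMaximally cl I γ) (h : Fin 4 → G)
    (F : Finset M) : ∃ (h' : Fin 4 → G) (E₀ : Finset M), (∀ i, AgreeOn cl (h' i) (h i) F) ∧
      IsFree cl γ h' F E₀ := by
  set g₁ := (h 3)⁻¹ * γ * h 3 with hg₁
  set g₂ := (h 2)⁻¹ * γ * h 2 with hg₂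
  set g₃ := (h 1)⁻¹ * γ * h 1 with hg₃
  set g₄ := (h 0)⁻¹ * γ * h 0 with hg₄
  -- Chosen in the middle so that both neighbours, `g₂⁻¹ • Y₂` and `g₃ • Y₂`, contain `F`. The two
  -- ends are then freed by altering only `h 3` and `h 0`.
  set Y₂ := F ∪ g₂ • F ∪ g₃⁻¹ • F with hY₂
  have hF₁ : F ⊆ g₂⁻¹ • Y₂ := by
    rw [hY₂, Finset.smul_finset_union, Finset.smul_finset_union, inv_smul_smul]
    grind
  have hF₃ : F ⊆ g₃ • Y₂ := by
    rw [hY₂, Finset.smul_finset_union, Finset.smul_finset_union, smul_inv_smul]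
    grind
  obtain ⟨u, hu, hu'⟩ := hI.existence (g₁⁻¹ • g₂⁻¹ • Y₂) (g₂⁻¹ • Y₂) Y₂
  obtain ⟨v, hv, hv'⟩ := hI.existence (g₄ • g₃ • Y₂) (g₃ • Y₂) Y₂
  refine ⟨![h 0 * v⁻¹, h 1, h 2, h 3 * u⁻¹], u • g₁⁻¹ • g₂⁻¹ • Y₂, ?_, ?_⟩
  · simp only [Fin.forall_fin_succ]
    refine ⟨?_, AgreeOn.refl _ _, AgreeOn.refl _ _, ?_, fun i => i.elim0⟩
    · simpa using ((hv.mono hF₃).inv_one hI).mul_left (h 0)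
    · simpa using ((hu.mono hF₁).inv_one hI).mul_left (h 3)
  · refine isFree_of_chain hI H _ (Y₁ := g₂⁻¹ • Y₂) (Y₂ := Y₂) (Y₃ := g₃ • Y₂)
      (Y₄ := v • g₄ • g₃ • Y₂) ?_ ?_ ?_ ?_ hu' hv' hF₁ hF₃
    · have : (h 3 * u⁻¹)⁻¹ * γ * (h 3 * u⁻¹) = u * g₁ * u⁻¹ := by rw [hg₁]; group
      change ((h 3 * u⁻¹)⁻¹ * γ * (h 3 * u⁻¹)) • _ = _
      rw [this]
      simp only [mul_smul, inv_smul_smul, smul_inv_smul]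
      rw [hu.smul_finset_eq_self subset_rfl]
    · exact smul_inv_smul g₂ Y₂
    · rfl
    · have : (h 0 * v⁻¹)⁻¹ * γ * (h 0 * v⁻¹) = v * g₄ * v⁻¹ := by rw [hg₄]; group
      change ((h 0 * v⁻¹)⁻¹ * γ * (h 0 * v⁻¹)) • _ = _
      rw [this]
      simp only [mul_smul]
      rw [(hv.inv_one hI).smul_finset_eq_self subset_rfl]

theorem isFree_empty (hI : FinsetIndep G cl I) (H : MovesMaximally cl I γ) (h : Fin 4 → G) :
    IsFree cl γ h ∅ ∅ :=
  isFree_of_chain hI H h (Y₁ := ∅) (Y₂ := ∅) (Y₃ := ∅) (Y₄ := ∅) (by simp) (by simp) (by simp)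
    (by simp) (hI.self_right _ _) (hI.self_right _ _) subset_rfl subset_rfl

/-- A finite stage of the back-and-forth construction of `h` and `h'` with
`conjProd γ h * conjProd γ h' = k`. -/
structure Stage (cl : ClosureOperator (Set M)) (γ k : G) where
  /-- the approximation of the first tuple -/
  h : Fin 4 → G
  /-- the set on which the first tuple is decided -/
  F : Finset M
  /-- the set on which the first product is decided -/
  E : Finset M
  /-- the approximation of the second tuple -/
  h' : Fin 4 → G
  /-- the set on which the second tuple is decided -/
  F' : Finset M
  isFree : IsFree cl γ h F E
  agreeOn : ∀ p : Fin 4 → G, (∀ i, AgreeOn cl (p i) (h' i) F') →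
    AgreeOn cl (k * (conjProd γ p)⁻¹) (conjProd γ h) E

theorem exists_subset_inv_smul (F S : Finset M) (h : Fin 4 → G) :
    ∃ F' : Finset M, F ⊆ F' ∧ S ⊆ F' ∧ ∀ i, (h i)⁻¹ • S ⊆ F' := by
  refine ⟨F ∪ S ∪ Finset.univ.biUnion fun i => (h i)⁻¹ • S, by grind, by grind, fun i => ?_⟩
  exact (Finset.subset_biUnion_of_mem (fun i => (h i)⁻¹ • S) (Finset.mem_univ i)).trans
    Finset.subset_union_right

/-- Freeness of each tuple absorbs the refinement of the other: make the second free, adjust the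
first to match it, make the first free, then adjust the second. Continuity keeps each match stable
under the next change. -/
theorem Stage.exists_next (hI : FinsetIndep G cl I) (H : MovesMaximally cl I γ) {k : G}
    (S : Finset M) (s : Stage cl γ k) : ∃ t : Stage cl γ k,
      ((∀ i, AgreeOn cl (t.h i) (s.h i) s.F) ∧ s.F ⊆ t.F ∧ S ⊆ t.F ∧
        ∀ i, (t.h i)⁻¹ • S ⊆ t.F) ∧
      ((∀ i, AgreeOn cl (t.h' i) (s.h' i) s.F') ∧ s.F' ⊆ t.F' ∧ S ⊆ t.F' ∧
        ∀ i, (t.h' i)⁻¹ • S ⊆ t.F') ∧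
      AgreeOn cl (conjProd γ t.h * conjProd γ t.h') k S := by
  obtain ⟨F', hF', hSF', hinvF'⟩ := exists_subset_inv_smul s.F' S s.h'
  obtain ⟨p', E', hp', hfree'⟩ := exists_isFree hI H s.h' F'
  obtain ⟨p, hp, hpE⟩ := s.isFree _ (s.agreeOn p' fun i => (hp' i).mono hF')
    (conjProd γ p' • E')
  have hpE' : AgreeOn cl ((conjProd γ p)⁻¹ * k) (conjProd γ p') E' := by
    have := ((hpE.mul_right hI).mul_left (conjProd γ p)⁻¹).symm
    simpa [mul_assoc] using this
  obtain ⟨F₀, hF₀⟩ := exists_agreeOn_conjProd (cl := cl) hI γ p (conjProd γ p' • E')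
  obtain ⟨F, hF, hSF, hinvF⟩ := exists_subset_inv_smul (s.F ∪ F₀) S p
  obtain ⟨q, E, hq, hfree⟩ := exists_isFree hI H p F
  have hqE' : AgreeOn cl ((conjProd γ q)⁻¹ * k) (conjProd γ p') E' := by
    have h1 := hF₀ q fun i => (hq i).mono (by grind)
    have h2 := ((h1.trans hpE).mul_right hI).mul_left (conjProd γ q)⁻¹
    simpa [mul_assoc] using h2.symm
  -- The second set is the preimage of `E` under `(conjProd γ q)⁻¹ * k`; agreement there controls
  -- the inverse of the second product on `E`, as the stage invariant requires.
  obtain ⟨q', hq', hqk⟩ := hfree' _ hqE' (S ∪ (k⁻¹ * conjProd γ q) • E)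
  obtain ⟨F₁, hF₁⟩ := exists_agreeOn_conjProd (cl := cl) hI γ q' ((k⁻¹ * conjProd γ q) • E)
  refine ⟨⟨q, F, E, q', F' ∪ F₁, hfree, fun r hr => ?_⟩, ⟨?_, ?_, hSF, ?_⟩, ⟨?_, ?_, ?_, ?_⟩, ?_⟩
  · have h1 := (hF₁ r fun i => (hr i).mono Finset.subset_union_right).trans
      (hqk.mono Finset.subset_union_right)
    have e := h1.smul_finset_eq subset_rfl
    have h2 := h1.inv hI
    rw [e, ← mul_smul, show (conjProd γ q)⁻¹ * k * (k⁻¹ * conjProd γ q) = 1 by group,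
      one_smul] at h2
    simpa using h2.mul_left k
  · exact fun i => ((hq i).mono (by grind)).trans (hp i)
  · grind
  · exact fun i => (hq i).inv_smul_finset_subset (hinvF i)
  · exact fun i => ((hq' i).trans (hp' i)).mono hF'
  · exact hF'.trans Finset.subset_union_left
  · exact hSF'.trans Finset.subset_union_left
  · exact fun i => (((hq' i).trans (hp' i)).inv_smul_finset_subset (hinvF' i)).trans
      Finset.subset_union_left
  · simpa using (hqk.mono Finset.subset_union_left).mul_left (conjProd γ q)

/-- Every element is a product of eight conjugates of a maximally moving element. -/
theorem exists_conjProd_mul_conjProd [Countable M] (hI : FinsetIndep G cl I)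
    (hlim : HasLimits G M) (hfix : ∀ g : G, AgreeOn cl g 1 (∅ : Finset M))
    (H : MovesMaximally cl I γ) (k : G) :
    ∃ h h' : Fin 4 → G, ∀ x : M, (conjProd γ h * conjProd γ h') • x = k • x := by
  obtain ⟨S, hS, hS'⟩ := exists_monotone_finset_exhaustion M
  obtain ⟨s, -, hs⟩ := exists_seq_of_forall_exists
    -- The empty stage is consistent because the whole group fixes `cl ∅` pointwise.
    (⟨1, ∅, ∅, 1, ∅, isFree_empty hI H 1, fun _ _ => (hfix _).trans (hfix _).symm⟩ :
      Stage cl γ k) fun n => Stage.exists_next hI H (S n)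
  have hlim₁ : ∀ i, ∃ l : G, ∀ n, AgreeOn cl l ((s n).h i) (s n).F := fun i =>
    hlim.exists_limit hS' (fun n => (hs n).1.2.1) (fun n => (hs n).1.1 i)
      (fun n => (hs n).1.2.2.1) fun n => (hs n).1.2.2.2 i
  have hlim₂ : ∀ i, ∃ l : G, ∀ n, AgreeOn cl l ((s n).h' i) (s n).F' := fun i =>
    hlim.exists_limit hS' (fun n => (hs n).2.1.2.1) (fun n => (hs n).2.1.1 i)
      (fun n => (hs n).2.1.2.2.1) fun n => (hs n).2.1.2.2.2 i
  choose h hh using hlim₁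
  choose h' hh' using hlim₂
  refine ⟨h, h', fun x => ?_⟩
  obtain ⟨F', hF'⟩ := exists_agreeOn_conjProd (cl := cl) hI γ h' {x}
  obtain ⟨F, hF⟩ := exists_agreeOn_conjProd (cl := cl) hI γ h (conjProd γ h' • {x})
  have hcov : ∀ T : Finset M, ∃ n, T ⊆ S n := fun T => by
    induction T using Finset.induction_on with
    | empty => exact ⟨0, Finset.empty_subset _⟩
    | insert a T _ ih =>
      obtain ⟨m, hm⟩ := ih
      obtain ⟨n, hn⟩ := hS' a
      exact ⟨max m n, Finset.insert_subset (hS (le_max_right m n) hn)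
        (hm.trans (hS (le_max_left m n)))⟩
  obtain ⟨n, hn⟩ := hcov (F ∪ F' ∪ {x})
  have h1 := hF' (s (n + 1)).h' fun i =>
    ((hh' i (n + 1)).mono ((by grind : F' ⊆ S n).trans (hs n).2.1.2.2.1)).symm
  have h2 := hF (s (n + 1)).h fun i =>
    ((hh i (n + 1)).mono ((by grind : F ⊆ S n).trans (hs n).1.2.2.1)).symm
  have h3 := (h2.mul' hI h1).smul_eq (Finset.mem_singleton_self x)
  rw [← h3]
  exact (hs n).2.2.smul_eq (by grind)

end BackAndForth

/-! ### From almost maximal to maximal movement. -/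

section AlmostMaximal

variable {G : Type*} {M : Type*} [Group G] [MulAction G M] [DecidableEq M]
  {cl : ClosureOperator (Set M)} {I : Finset M → Finset M → Finset M → Prop} {g : G}

/-- The type of `a` over `X` has a realisation that is moved by `γ` as freely as possible. -/
def MovesType (cl : ClosureOperator (Set M)) (I : Finset M → Finset M → Finset M → Prop)
    (γ : G) (X : Finset M) (a : M) : Prop :=
  ∃ u : G, AgreeOn cl u 1 X ∧ I {u • a} X (γ • X ∪ {γ • u • a}) ∧
    I ({u • a} ∪ X) (γ • X) {γ • u • a}

/-- Any finite approximation of `h` can be extended so that `h⁻¹ * g * h * g` moves a given type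
maximally. -/
theorem exists_forces_movesType (hI : FinsetIndep G cl I)
    (hg : ∀ (B : Finset M) (a : M), ∃ f : G, AgreeOn cl f 1 B ∧ I {f • a} B {g • f • a})
    (h : G) (P X : Finset M) (a : M) :
    ∃ (h' : G) (P' : Finset M), AgreeOn cl h' h P ∧ P ⊆ P' ∧
      ∀ p : G, AgreeOn cl p h' P' → MovesType cl I (p⁻¹ * g * p * g) X a := by
  set Z := h⁻¹ • g • h • g • X with hZ
  set P₁ := P ∪ g • X ∪ Z with hP₁
  set Q := h • P₁ with hQ
  have hgX : g • X ⊆ P₁ := by grind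
  have hZP : Z ⊆ P₁ := by grind
  have hhgX : h • g • X ⊆ Q := Finset.smul_finset_subset_smul_finset hgX
  -- The translate `g⁻¹ • P₁` is included so that `g • a₀` becomes free from `P₁`; `g⁻¹ • Q` below
  -- plays the same role.
  obtain ⟨u, hu, hu'⟩ := hI.existence {a} X (P₁ ∪ g⁻¹ • P₁)
  rw [Finset.smul_finset_singleton] at hu'
  set a₀ := u • a
  have h1 : I {g • a₀} (g • X) P₁ := by
    have := hI.smul g (hI.mono hu' Finset.subset_union_right)
    rwa [smul_inv_smul, Finset.smul_finset_singleton] at this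
  have h2 : I {h • g • a₀} (h • g • X) Q := by
    have := hI.smul h h1
    rwa [Finset.smul_finset_singleton] at this
  obtain ⟨v, hv, hv'⟩ := hI.existence {h • g • a₀} Q (Q ∪ g⁻¹ • Q)
  rw [Finset.smul_finset_singleton] at hv'
  -- The only use of almost maximality: `b` is free from `g • b`.
  obtain ⟨w, hw, hw'⟩ := hg (Q ∪ g⁻¹ • Q) (v • h • g • a₀)
  have hwQ : AgreeOn cl w 1 Q := hw.mono Finset.subset_union_left
  set b := w • v • h • g • a₀ with hb
  have h3 : I {v • h • g • a₀} (h • g • X) (Q ∪ g⁻¹ • Q) := by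
    have := hI.smul v h2
    rw [hv.smul_finset_eq_self hhgX, hv.smul_finset_eq_self subset_rfl,
      Finset.smul_finset_singleton] at this
    exact hI.mono (hI.trans_of_subset hhgX this hv') Finset.subset_union_right
  have h4 : I {b} (h • g • X) (Q ∪ g⁻¹ • Q ∪ {g • b}) := by
    have := hI.smul w h3
    rw [hwQ.smul_finset_eq_self hhgX, hw.smul_finset_eq_self subset_rfl,
      Finset.smul_finset_singleton] at this
    exact hI.trans_of_subset (hhgX.trans Finset.subset_union_left) this hw'
  have h5 : I {g • b} (g • h • g • X) Q := by
    have := hI.smul g (hI.mono h4 (C := g⁻¹ • Q) (by grind))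
    rwa [smul_inv_smul, Finset.smul_finset_singleton] at this
  have h6 : I {b} Q {g • b} := by
    refine hI.mono (hI.base_mono h4 hhgX (by grind)) (by grind)
  set h₁ := w * v * h with hh₁
  have hagree : AgreeOn cl h₁ h P₁ := by
    have : AgreeOn cl (w * v) 1 Q := (hv.mul_left w).trans (by simpa using hwQ)
    simpa using this.mul_right hI
  have hh₁a : h₁ • g • a₀ = b := by simp only [hh₁, mul_smul, hb]
  have hh₁Z : h₁ • Z = g • h • g • X := by
    rw [hagree.smul_finset_eq hZP, hZ, smul_inv_smul]
  have hh₁P : h₁ • P₁ = Q := hagree.smul_finset_eq subset_rfl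
  have h7 : I {h₁⁻¹ • g • b} Z P₁ := by
    have := hI.smul h₁⁻¹ h5
    rwa [← hh₁Z, ← hh₁P, inv_smul_smul, inv_smul_smul, Finset.smul_finset_singleton] at this
  have h8 : I {h₁⁻¹ • g • b} P₁ {g • a₀} := by
    have := hI.symm (hI.smul h₁⁻¹ h6)
    rwa [← hh₁P, inv_smul_smul, Finset.smul_finset_singleton, Finset.smul_finset_singleton,
      ← hh₁a, inv_smul_smul, hh₁a] at this
  -- Freeness of `c` from `{a₀} ∪ X` over `Z` comes by transitivity through `P₁` and `P₁ ∪ {g •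
  -- a₀}`.
  obtain ⟨z, hz, hz'⟩ := hI.existence {h₁⁻¹ • g • b} (P₁ ∪ {g • a₀}) ({a₀} ∪ X)
  have hzP : AgreeOn cl z 1 P₁ := hz.mono Finset.subset_union_left
  rw [Finset.smul_finset_singleton] at hz'
  set c := z • h₁⁻¹ • g • b with hc
  have h9 : I {c} Z ({a₀} ∪ X) := by
    have e1 := hI.smul z h7
    have e2 := hI.smul z h8
    rw [hzP.smul_finset_eq_self hZP, hzP.smul_finset_eq_self subset_rfl,
      Finset.smul_finset_singleton] at e1
    rw [hz.smul_finset_eq_self Finset.subset_union_right, hzP.smul_finset_eq_self subset_rfl,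
      Finset.smul_finset_singleton] at e2
    exact hI.mono (hI.trans_of_subset (hZP.trans Finset.subset_union_left)
      (hI.trans_of_subset hZP e1 e2) hz') Finset.subset_union_right
  have hagree₂ : AgreeOn cl (h₁ * z⁻¹) h₁ (P₁ ∪ {g • a₀}) := by
    simpa using (hz.inv_one hI).mul_left h₁
  refine ⟨h₁ * z⁻¹, P₁ ∪ {g • a₀} ∪ {c}, ?_, by grind, fun p hp => ⟨u, hu, ?_⟩⟩
  · exact (hagree₂.mono (by grind)).trans (hagree.mono (by grind))
  have hpP : AgreeOn cl p h P₁ :=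
    (hp.mono (by grind)).trans ((hagree₂.mono (by grind)).trans hagree)
  have hX : (p⁻¹ * g * p * g) • X = Z := by
    simp only [mul_smul]
    rw [hpP.smul_finset_eq hgX, inv_smul_eq_iff, hpP.smul_finset_eq hZP, hZ, smul_inv_smul]
  have ha : (p⁻¹ * g * p * g) • a₀ = c := by
    simp only [mul_smul]
    rw [hp.smul_eq (x := g • a₀) (by grind), hagree₂.smul_eq (by grind), hh₁a, inv_smul_eq_iff,
      hp.smul_eq (x := c) (by grind), mul_smul, hc, inv_smul_smul, smul_inv_smul]
  change I {a₀} X ((p⁻¹ * g * p * g) • X ∪ {(p⁻¹ * g * p * g) • a₀}) ∧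
    I ({a₀} ∪ X) ((p⁻¹ * g * p * g) • X) {(p⁻¹ * g * p * g) • a₀}
  rw [hX, ha]
  refine ⟨hI.trans (hI.mono hu' (by grind)) ?_, hI.symm h9⟩
  rw [Finset.union_comm X Z]
  exact hI.symm (hI.base_of_union (by rwa [Finset.union_comm X]))

/-- If `g` moves almost maximally, then the product of `g` and a conjugate of `g` moves
maximally. -/
theorem exists_movesMaximally [Countable M] (hI : FinsetIndep G cl I) (hlim : HasLimits G M)
    (hg : ∀ (B : Finset M) (a : M), ∃ f : G, AgreeOn cl f 1 B ∧ I {f • a} B {g • f • a}) :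
    ∃ h : G, MovesMaximally cl I (h⁻¹ * g * h * g) := by
  obtain ⟨S, -, hS⟩ := exists_monotone_finset_exhaustion M
  rcases isEmpty_or_nonempty M with hM | hM
  · exact ⟨1, MovesMaximally.of_singleton hI fun _ a => isEmptyElim a⟩
  -- Countability of `M` lets one limit handle every type, each at its own stage.
  obtain ⟨t, ht⟩ := exists_surjective_nat (Finset M × M)
  have step : ∀ (n : ℕ) (x : G × Finset M), ∃ y : G × Finset M,
      AgreeOn cl y.1 x.1 x.2 ∧ x.2 ⊆ y.2 ∧ S n ⊆ y.2 ∧ y.1⁻¹ • S n ⊆ y.2 ∧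
      ∀ p : G, AgreeOn cl p y.1 y.2 → MovesType cl I (p⁻¹ * g * p * g) (t n).1 (t n).2 := by
    rintro n ⟨h, P⟩
    obtain ⟨h', P', h1, h2, h3⟩ := exists_forces_movesType hI hg h P (t n).1 (t n).2
    exact ⟨(h', P' ∪ (S n ∪ h'⁻¹ • S n)), h1, h2.trans Finset.subset_union_left,
      Finset.subset_union_left.trans Finset.subset_union_right,
      Finset.subset_union_right.trans Finset.subset_union_right,
      fun p hp => h3 p (hp.mono Finset.subset_union_left)⟩
  obtain ⟨s, -, hs⟩ := exists_seq_of_forall_exists ((1, ∅) : G × Finset M) step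
  obtain ⟨l, hl⟩ := hlim.exists_limit (cl := cl) (h := fun n => (s n).1)
    (F := fun n => (s n).2) hS (fun n => (hs n).2.1) (fun n => (hs n).1)
    (fun n => (hs n).2.2.1) fun n => (hs n).2.2.2.1
  refine ⟨l, MovesMaximally.of_singleton hI fun X a => ?_⟩
  obtain ⟨n, hn⟩ := ht (X, a)
  have := (hs n).2.2.2.2 l (hl (n + 1))
  rwa [hn] at this

end AlmostMaximal

/-! ### Application to automorphism groups. -/

section Automorphisms

variable {L : FirstOrder.Language.{u, v}} {M : Type w} [L.Structure M]

instance autMulAction : MulAction (M ≃[L] M) M where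
  smul f x := f x
  one_smul _ := rfl
  mul_smul _ _ _ := rfl

/-- Function and relation symbols involve only finite tuples, on which the limit coincides with a
late `h n`; exhaustion of the range gives surjectivity. -/
theorem aut_hasLimits : HasLimits (M ≃[L] M) M := by
  intro h D hD hh hx hy
  have stable : ∀ m n, m ≤ n → ∀ x ∈ D m, h n x = h m x := fun m n hmn x hxm => by
    induction n, hmn using Nat.le_induction with
    | base => rfl
    | succ n hmn ih => exact (hh n x (hD hmn hxm)).trans ih
  choose N hN using hx
  set l : M → M := fun x => h (N x) x with hl
  have hlD : ∀ n, ∀ x ∈ D n, l x = h n x := fun n x hxn => by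
    rcases le_total (N x) n with hle | hle
    · exact (stable _ _ hle x (hN x)).symm
    · exact stable _ _ hle x hxn
  have inj : Function.Injective l := fun x y hxy => by
    have h1 := hlD (max (N x) (N y)) x (hD (le_max_left _ _) (hN x))
    have h2 := hlD (max (N x) (N y)) y (hD (le_max_right _ _) (hN y))
    exact (h (max (N x) (N y))).injective (h1.symm.trans (hxy.trans h2))
  have surj : Function.Surjective l := fun y => by
    obtain ⟨n, hn⟩ := hy y
    exact ⟨_, (hlD n _ hn).trans (smul_inv_smul (h n) y)⟩
  have tuple : ∀ {k : ℕ} (xs : Fin k → M), ∃ n, ∀ m, n ≤ m → l ∘ xs = h m ∘ xs := fun xs => by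
    refine ⟨Finset.univ.sup fun i => N (xs i), fun m hm => funext fun i => ?_⟩
    exact hlD m _ (hD ((Finset.le_sup (f := fun i => N (xs i)) (Finset.mem_univ i)).trans hm)
      (hN _))
  refine ⟨⟨Equiv.ofBijective l ⟨inj, surj⟩, ?_, ?_⟩, hlD⟩
  · intro k f xs
    obtain ⟨n, hn⟩ := tuple xs
    change l _ = FirstOrder.Language.Structure.funMap f (l ∘ xs)
    set y := FirstOrder.Language.Structure.funMap f xs
    rw [hn (max n (N y)) (le_max_left _ _), hlD (max n (N y)) y (hD (le_max_right _ _) (hN y))]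
    exact (h _).map_fun f xs
  · intro k r xs
    obtain ⟨n, hn⟩ := tuple xs
    change FirstOrder.Language.Structure.RelMap r (l ∘ xs) ↔ _
    rw [hn n le_rfl]
    exact (h n).map_rel r xs

/-- A stationary independence relation, restricted to closures of finite sets. -/
theorem IsStationaryIndep.finsetIndep [DecidableEq M] {cl : ClosureOperator (Set M)}
    (hinv : IsInvariant L cl) {Ind : Set M → Set M → Set M → Prop}
    (hInd : IsStationaryIndep L cl Ind) :
    FinsetIndep (M ≃[L] M) cl fun A B C => Ind (cl A) (cl B) (cl C) := by
  have mem : ∀ A : Finset M, cl (A : Set M) ∈ finClosed cl := fun A => ⟨A, A.finite_toSet, rfl⟩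
  have clu : ∀ A B : Finset M,
      cl (cl (A : Set M) ∪ cl (B : Set M)) = cl ((A ∪ B : Finset M) : Set M) := fun A B => by
      rw [Finset.coe_union]
      exact cl.closure_sup_closure _ _
  have cls : ∀ (f : M ≃[L] M) (A : Finset M), cl ((f • A : Finset M) : Set M) = f '' cl A :=
    fun f A => by
      rw [Finset.coe_smul_finset]
      exact hinv f A
  have image_eq : ∀ (f : M ≃[L] M) (B : Finset M), Fixes f (cl B) → f '' cl (B : Set M) = cl B :=
    fun f B hf => (Set.image_congr hf).trans (Set.image_id' _)
  have uni : ∀ A B C D : Finset M, Ind (cl A) (cl B) (cl ((C ∪ D : Finset M) : Set M)) ↔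
      Ind (cl A) (cl B) (cl C) ∧ Ind (cl A) (cl ((B ∪ C : Finset M) : Set M)) (cl D) := by
    intro A B C D
    rw [← clu, ← clu]
    exact ⟨hInd.monotonicity _ (mem A) _ (mem B) _ (mem C) _ (mem D),
      fun H => hInd.transitivity _ (mem A) _ (mem B) _ (mem C) _ (mem D) H.1 H.2⟩
  have self : ∀ A B : Finset M, Ind (cl A) (cl B) (cl B) := fun A B => by
    -- Independence from the base itself is not an axiom: take a free copy over `B` and pull it back
    -- by `f⁻¹`, which fixes `B`.
    obtain ⟨f, hf, hf'⟩ := hInd.existence _ (mem A) _ (mem B) _ (mem B)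
    have := hInd.invariance f⁻¹ _ (cls f A ▸ mem (f • A)) _ (mem B) _ (mem B) hf'
    have e : (f⁻¹ : M ≃[L] M) '' cl (B : Set M) = cl B := by
      refine image_eq _ _ fun x hx => ?_
      have := f.symm_apply_apply x
      rwa [hf x hx] at this
    rw [e, Set.image_image] at this
    convert this
    exact ((Set.image_congr fun x _ => f.symm_apply_apply x).trans (Set.image_id' _)).symm
  have symm : ∀ A B C : Finset M, Ind (cl A) (cl B) (cl C) → Ind (cl C) (cl B) (cl A) :=
    fun A B C => hInd.symmetry _ (mem A) _ (mem B) _ (mem C)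
  have base : ∀ A B C : Finset M, Ind (cl A) (cl B) (cl C) →
      Ind (cl ((B ∪ A : Finset M) : Set M)) (cl B) (cl C) := fun A B C H =>
    symm _ _ _ ((uni _ _ _ _).2 ⟨self C B, by rw [Finset.union_self]; exact symm _ _ _ H⟩)
  refine ⟨fun f X => hinv f X, ?_, symm _ _ _, uni _ _ _ _, self, ?_, ?_⟩
  · intro f A B C H
    rw [cls, cls, cls]
    exact hInd.invariance f _ (mem A) _ (mem B) _ (mem C) H
  · intro A B C
    obtain ⟨f, hf, hf'⟩ := hInd.existence _ (mem A) _ (mem B) _ (mem C)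
    exact ⟨f, hf, by rwa [cls]⟩
  · intro A B C f hf H H'
    have hBA : f • (B ∪ A) = B ∪ f • A := by
      rw [Finset.smul_finset_union, hf.smul_finset_eq_self subset_rfl]
    have hsub : ∀ A : Finset M, cl (B : Set M) ⊆ cl ((B ∪ A : Finset M) : Set M) := fun A =>
      cl.monotone (Finset.coe_subset.2 Finset.subset_union_left)
    -- The axiom wants the base inside the left-hand sets, so `B` is adjoined to them.
    obtain ⟨k, hk, hk'⟩ := hInd.stationarity _ (mem (B ∪ A)) _ (mem (B ∪ f • A)) _ (mem B) _
      (mem C) (hsub A) (hsub _) (base _ _ _ H) (base _ _ _ H') f (by rw [← hBA, cls]) hf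
    rw [Finset.union_comm]
    exact ⟨k, hk, hk'⟩

theorem MovesAlmostMaximally.exists_finsetIndep {cl : ClosureOperator (Set M)}
    {Ind : Set M → Set M → Set M → Prop} (hInd : IsStationaryIndep L cl Ind) {g : M ≃[L] M}
    [DecidableEq M] (hI : FinsetIndep (M ≃[L] M) cl fun A B C => Ind (cl A) (cl B) (cl C))
    (hg : MovesAlmostMaximally cl Ind g) (B : Finset M) (a : M) :
    ∃ f : M ≃[L] M, AgreeOn cl f 1 B ∧
      Ind (cl (({f • a} : Finset M) : Set M)) (cl B) (cl (({g • f • a} : Finset M) : Set M)) := by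
  obtain ⟨f, hf, hf'⟩ := hg _ ⟨B, B.finite_toSet, rfl⟩ a
  refine ⟨f, hf, ?_⟩
  rw [hInd.compat_closure _ (Set.finite_singleton _) _ ⟨B, B.finite_toSet, rfl⟩ _
    ⟨_, Set.finite_singleton _, rfl⟩] at hf'
  have e : cl ({f a} ∪ cl (B : Set M)) = cl (({f • a} ∪ B : Finset M) : Set M) := by
    rw [Finset.coe_union, Finset.coe_singleton]
    exact cl.closure_sup_closure_right _ _
  rw [e] at hf'
  refine hI.mono_left (D := {f • a} ∪ B) ?_ Finset.subset_union_left
  rw [Finset.coe_singleton]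
  exact hf'

end Automorphisms

end StatIndep

theorem theorem2p7 {L : FirstOrder.Language.{u, v}} {M : Type w} [L.Structure M] [Countable M]
    (cl : ClosureOperator (Set M))
    (hinv : StatIndep.IsInvariant L cl)
    (hfin : StatIndep.IsFinitary cl)
    (hdcl : StatIndep.SubsumesDcl L cl)
    (Ind : Set M → Set M → Set M → Prop)
    (hInd : StatIndep.IsStationaryIndep L cl Ind)
    (hfix : ∀ f : M ≃[L] M, StatIndep.Fixes f (cl ∅))
    (g : M ≃[L] M) (hg : StatIndep.MovesAlmostMaximally cl Ind g)
    (k : M ≃[L] M) :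
    ∃ h : Fin 16 → (M ≃[L] M), k = (List.ofFn fun i => (h i)⁻¹ * g * h i).prod := by
  classical
  have hI := hInd.finsetIndep hinv
  obtain ⟨r, hr⟩ := StatIndep.exists_movesMaximally hI StatIndep.aut_hasLimits
    (hg.exists_finsetIndep hInd hI)
  obtain ⟨p, q, hpq⟩ := StatIndep.exists_conjProd_mul_conjProd hI StatIndep.aut_hasLimits
    (fun f x hx => hfix f x (by simpa using hx)) hr k
  -- Conjugating `r⁻¹ * g * r * g` by `x` gives the conjugate of `g` by `r * x` times that by `x`.
  refine ⟨![r * p 0, p 0, r * p 1, p 1, r * p 2, p 2, r * p 3, p 3,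
    r * q 0, q 0, r * q 1, q 1, r * q 2, q 2, r * q 3, q 3], ?_⟩
  have hk : k = StatIndep.conjProd (r⁻¹ * g * r * g) p *
      StatIndep.conjProd (r⁻¹ * g * r * g) q :=
    FirstOrder.Language.Equiv.ext fun x => (hpq x).symm
  rw [hk]
  simp [StatIndep.conjProd, List.ofFn_succ, mul_assoc]
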